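/- **Definitions.** For real $a$ and integer $k\ge 0$ let $(a)_k=a(a+1)\cdots(a+k-1)$, $(a)_0=1$; empty products equal $1$; $m!!$ is the double factorial, with $(-1)!!=0!!=1$; and $${}_4F_3\left(\begin{matrix}a_1,a_2,a_3,a_4\\ b_1,b_2,b_3\end{matrix};t\right)=\sum_{k\ge 0}\frac{(a_1)_k(a_2)_k(a_3)_k(a_4)_k}{(b_1)_k(b_2)_k(b_3)_k\,(1)_k}\,t^k .$$ Let $\hat p_j$ be the Legendre polynomial of degree $j$ that is orthonormal on $[-1,1]$ and has positive leading coefficient. For $0\le i\le n$ with $i=0$ or $i$ odd, and $0\le k\le n$, put $$d^i_{n,k}=(-1)^n\frac{\sqrt{2n-2i+1}}{(-n)_i}\,\frac{(-n)_k(n-i+1)_k}{(1)_k(1)_k}\prod_{m=0}^{\frac{i-1}{2}}(n+k+1-2m)\prod_{m=0}^{\frac{i-3}{2}}(n-k-1-2m).$$ For $0\le t<1$ let $h^n_{n-i}(t)=\sum_{k=0}^n d^i_{n,k}t^k$ if $i=0$ or $i$ is odd, and $h^n_{n-i}(t)=\sum_{k=0}^{n-1}d^{i-1}_{n-1,k}t^k$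 if $i>0$ is even; extend $h^n_r$ to $[-1,0)$ by $h^n_r(-t)=(-1)^{r+1}h^n_r(t)$. Let $\psi^n_r(t)=h^n_r(2t-1)\chi_{[0,1)}(t)$, and let $D^n_1$ be the $(n+1)\times(n+1)$ matrix with entries $$(D^n_1)_{r,c}=2\int_0^1\psi^n_r\left(\tfrac{t+1}{2}\right)\hat p_c(2t-1)\,dt=2\int_0^1h^n_r(t)\,\hat p_c(2t-1)\,dt,\qquad 0\le r,c\le n.$$ **Lemma.** Let $0\le j<i\le n$ be integers. (a) If $i$ is odd and $j$ is even, then $$(D^n_1)_{n-i,n-j}=(-1)^{\frac{i-j+1}{2}}\frac{(j+1)!!\,(i-j-2)!!}{2^{i/2}\left(n-\frac{i+j-1}{2}\right)_{\frac{i+1}{2}}}\sqrt{2(n-i)+1}\,\sqrt{2(n-j)+1}\;{}_4F_3\left(\begin{matrix}-\frac j2,\ \frac{j-i+1}{2},\ n+\frac{3-j}{2},\ -n+\frac{i+j}{2}\\ 1,\ \frac12,\ \frac32\end{matrix};1\right).$$ (b) If $i$ and $j$ are odd, then $$(D^n_1)_{n-i,n-j}=(-1)^{\frac{i-j}{2}+1}\frac{j!!\,(i-j-1)!!}{2^{\frac{i+2}{2}}\left(n-\frac{i+j-2}{2}\right)_{\frac{i+1}{2}}}\sqrt{2(n-i)+1}\,\sqrt{2(n-j)+1}\,(2n-j+2)(j+1)\;{}_4F_3\left(\begin{matrix}-\frac{j-1}{2},\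 \frac{j-i}{2}+1,\ n-\frac j2+2,\ -n+\frac{i+j+1}{2}\\ 2,\ \frac32,\ \frac32\end{matrix};1\right).$$ (c) If $i$ is even, then $(D^n_1)_{n-i,n-j}=(D^{n-1}_1)_{n-i,n-j}$ for $j\ge 1$, and $(D^n_1)_{n-i,n}=0$ (the case $j=0$), so that (a) and (b) give all the entries with $j<i$. -/

import Mathlib

namespace AlpertWavelet

noncomputable section

/-- The rising factorial `(a)_k = a (a+1) ⋯ (a+k-1)`, with `(a)_0 = 1`. -/
def poch (a : ℝ) (k : ℕ) : ℝ := (ascPochhammer ℝ k).eval a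

/-- The generalized hypergeometric series with upper parameters `as` and lower parameters `bs`,
`∑ k, (∏ (a)_k) / ((∏ (b)_k) (1)_k) t ^ k`. -/
def hypergeom (as bs : List ℝ) (t : ℝ) : ℝ :=
  ∑' k : ℕ, (as.map (fun a => poch a k)).prod /
    ((bs.map (fun b => poch b k)).prod * poch 1 k) * t ^ k

/-- The Legendre polynomial of degree `n`, orthonormal on `[-1, 1]`, with positive leading
coefficient. Mathlib's `shiftedLegendre n` at `x` is the classical `P_n` at `1 - 2 x`. -/
def legendre (n : ℕ) (t : ℝ) : ℝ :=
  √(2 * (n : ℝ) + 1) / √2 *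
    Polynomial.aeval ((1 - t) / 2 : ℝ) (Polynomial.shiftedLegendre n)

/-- The coefficient `d^i_{n,k}` (used for `i = 0` or `i` odd, `i ≤ n`, `k ≤ n`). -/
def coeffD (n i k : ℕ) : ℝ :=
  (-1) ^ n * (√(2 * (n : ℝ) - 2 * (i : ℝ) + 1) / poch (-(n : ℝ)) i) *
    (poch (-(n : ℝ)) k * poch ((n : ℝ) - i + 1) k / (poch 1 k * poch 1 k)) *
    (∏ m ∈ Finset.range ((i + 1) / 2), ((n : ℝ) + k + 1 - 2 * m)) *
    (∏ m ∈ Finset.range ((i - 1) / 2), ((n : ℝ) - k - 1 - 2 * m))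

/-- The polynomial that equals `h^n_{n-i}` on `[0, 1)`. -/
def hPoly (n i : ℕ) (t : ℝ) : ℝ :=
  if i = 0 ∨ Odd i then ∑ k ∈ Finset.range (n + 1), coeffD n i k * t ^ k
  else ∑ k ∈ Finset.range n, coeffD (n - 1) (i - 1) k * t ^ k

/-- The function `h^n_r`, `0 ≤ r ≤ n`, supported on `[-1, 1)` and extended from `[0, 1)` to
`[-1, 0)` by `h^n_r (-t) = (-1) ^ (r + 1) h^n_r t`. -/
def h (n r : ℕ) (t : ℝ) : ℝ :=
  if 0 ≤ t ∧ t < 1 then hPoly n (n - r) t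
  else if -1 ≤ t ∧ t < 0 then (-1) ^ (r + 1) * hPoly n (n - r) (-t)
  else 0

/-- The wavelet `ψ^n_r (t) = h^n_r (2 t - 1) χ_[0,1) (t)`. -/
def psi (n r : ℕ) : ℝ → ℝ :=
  (Set.Ico (0 : ℝ) 1).indicator (fun t => h n r (2 * t - 1))

/-- The matrix `D^n_1 = 2 ∫_0^1 Ψ_n ((t + 1) / 2) P_n (2 t - 1)ᵀ dt`, rows and columns indexed
from `0` to `n`. -/
def D1 (n : ℕ) : Matrix (Fin (n + 1)) (Fin (n + 1)) ℝ :=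
  Matrix.of fun r c =>
    2 * ∫ t in (0 : ℝ)..1, psi n r ((t + 1) / 2) * legendre c (2 * t - 1)

end

end AlpertWavelet

namespace AlpertWavelet
open Finset

/-! Expanding an odd row in monomials reduces each entry to moments of a shifted Legendre
polynomial, which Saalschütz's theorem evaluates in closed form
(`integral_pow_mul_shiftedLegendre`). Write `i = 2q + 1`, `j = 2N + ε` with `ε ∈ {0, 1}`, and `k = n
- l`. Orthogonality kills the terms with `l > j`, and a zero factor in the coefficients kills those
with `l` odd. The terms `l = 2s`, `s ≤ N`, that remain have a rational ratio (`entryTerm_succ`), so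
their sum is the first term times a terminating balanced `₄F₃` at 1.

This is not yet the series of the statement. Two Sears–Whipple transformations carry the one into
the other (`hyperSum_two_step`), and `entryTerm_zero_mul_const` evaluates the accumulated factor.
The Sears–Whipple identity itself follows from Saalschütz's sum applied twice around an exchange of
summations. Keeping `ε` as a parameter treats (a) and (b) together.

For even `i > 0` the row polynomial is the one of index `i - 1` at level `n - 1`; this gives (c),
since its degree is below `n`. -/

/-! ### Rising factorials -/

@[simp] theorem poch_zero (a : ℝ) : poch a 0 = 1 := by simp [poch]

theorem poch_succ (a : ℝ) (k : ℕ) : poch a (k + 1) = poch a k * (a + k) := by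
  simp [poch, ascPochhammer_succ_eval]

theorem poch_add (a : ℝ) (k l : ℕ) : poch a (k + l) = poch a k * poch (a + k) l := by
  induction l with
  | zero => simp
  | succ l ih => rw [← add_assoc, poch_succ, poch_succ, ih]; push_cast; ring

theorem poch_succ_left (a : ℝ) (k : ℕ) : poch a (k + 1) = a * poch (a + 1) k := by
  rw [add_comm k 1, poch_add, poch_succ]; simp

theorem poch_eq_mul_of_le (a : ℝ) {k l : ℕ} (hkl : k ≤ l) :
    poch a l = poch a k * poch (a + k) (l - k) := by
  rw [← poch_add, Nat.add_sub_cancel' hkl]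

theorem poch_neg (a : ℝ) (k : ℕ) : poch (-a) k = (-1) ^ k * poch (a - k + 1) k := by
  induction k with
  | zero => simp
  | succ k ih =>
    rw [poch_succ, ih, poch_succ_left, pow_succ]
    push_cast
    rw [show a - (k + 1) + 1 + 1 = a - k + 1 by ring]
    ring

theorem poch_ne_zero {a : ℝ} {k : ℕ} (ha : ∀ m < k, a + m ≠ 0) : poch a k ≠ 0 := by
  induction k with
  | zero => simp
  | succ k ih =>
    rw [poch_succ]
    exact mul_ne_zero (ih fun m hm => ha m (by omega)) (ha k (by omega))

theorem poch_pos {a : ℝ} (ha : 0 < a) (k : ℕ) : 0 < poch a k := ascPochhammer_pos k a ha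

theorem poch_neg_natCast_eq_zero {N k : ℕ} (hk : N < k) : poch (-(N : ℝ)) k = 0 := by
  obtain ⟨p, rfl⟩ := Nat.exists_eq_add_of_lt hk
  rw [add_assoc, add_comm p, ← add_assoc, poch_add, poch_succ]; simp

theorem factorial_mul_poch (m k : ℕ) :
    (m.factorial : ℝ) * poch (m + 1) k = ((m + k).factorial : ℝ) := by
  induction k with
  | zero => simp
  | succ k ih =>
    rw [poch_succ, ← mul_assoc, ih, ← add_assoc, Nat.factorial_succ]; push_cast; ring

theorem poch_one (k : ℕ) : poch 1 k = (k.factorial : ℝ) := by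
  simpa using factorial_mul_poch 0 k

theorem factorial_mul_poch_neg {N k : ℕ} (hk : k ≤ N) :
    ((N - k).factorial : ℝ) * poch (-(N : ℝ)) k = (-1) ^ k * (N.factorial : ℝ) := by
  obtain ⟨p, rfl⟩ := Nat.exists_eq_add_of_le hk
  rw [poch_neg, show ((k + p : ℕ) : ℝ) - k + 1 = p + 1 by push_cast; ring,
    Nat.add_sub_cancel_left, mul_left_comm, factorial_mul_poch, add_comm p k]

theorem neg_one_pow_mul_choose_eq_poch {N k : ℕ} (hk : k ≤ N) :
    (-1) ^ k * (N.choose k : ℝ) = poch (-(N : ℝ)) k / poch 1 k := by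
  have h1 := factorial_mul_poch_neg hk
  have h2 : (N.choose k : ℝ) * k.factorial * (N - k).factorial = N.factorial := by
    exact_mod_cast Nat.choose_mul_factorial_mul_factorial hk
  have h3 : ((N - k).factorial : ℝ) ≠ 0 := by positivity
  rw [poch_one, eq_div_iff (by positivity)]
  apply mul_left_cancel₀ h3
  rw [h1, ← h2]; ring

theorem poch_two_mul (x : ℝ) (m : ℕ) :
    poch x (2 * m) = 4 ^ m * poch (x / 2) m * poch ((x + 1) / 2) m := by
  induction m with
  | zero => simp
  | succ m ih =>
    rw [show 2 * (m + 1) = 2 * m + 1 + 1 by ring, poch_succ, poch_succ, ih, poch_succ, poch_succ]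
    push_cast; ring

/-! ### Saalschütz's summation -/

/-- Creative telescoping: the complete sums should satisfy `S (k+1) = (v+w+k) (u+w+k) S k`, and the
difference of the two summands has the closed-form partial sums on the right. -/
theorem saalschutz_partial (u v w : ℝ) (k m : ℕ) (hm : m ≤ k) :
    ∑ r ∈ range (m + 1),
      (((k + 1).choose r : ℝ) * (poch u r * poch v r * poch w (k + 1 - r) *
          poch (u + v + w + r) (k + 1 - r)) -
        (v + w + k) * (u + w + k) * ((k.choose r : ℝ) * (poch u r * poch v r *
          poch w (k - r) * poch (u + v + w + r) (k - r)))) =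
      -((k.choose m : ℝ) * (poch u (m + 1) * poch v (m + 1) * poch w (k - m) *
          poch (u + v + w + m) (k - m))) := by
  induction m with
  | zero =>
    simp [poch_succ]
    ring
  | succ m ih =>
    rw [sum_range_succ, ih (by omega)]
    obtain ⟨p, rfl⟩ := Nat.exists_eq_add_of_le hm
    have e1 : m + 1 + p + 1 - (m + 1) = p + 1 := by omega
    have e2 : m + 1 + p - m = p + 1 := by omega
    have e3 : m + 1 + p - (m + 1) = p := by omega
    have hc : ((m + 1 + p).choose m : ℝ) * (p + 1) = ((m + 1 + p).choose (m + 1) : ℝ) * (m + 1) := by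
      have := Nat.choose_succ_right_eq (m + 1 + p) m
      rw [e2] at this
      exact_mod_cast this.symm
    rw [e1, e2, e3, Nat.choose_succ_succ (m + 1 + p) m, poch_succ_left (u + v + w + m) p,
      poch_succ (u + v + w + (m + 1 : ℕ)) p, poch_succ w p, poch_succ u (m + 1),
      poch_succ v (m + 1)]
    push_cast
    rw [show u + v + w + m + 1 = u + v + w + (m + 1) by ring]
    linear_combination (poch u (m + 1) * poch v (m + 1) * poch w p *
      poch (u + v + w + (m + 1)) p * (w + p)) * hc

theorem saalschutz (u v w : ℝ) (k : ℕ) :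
    ∑ r ∈ range (k + 1), (k.choose r : ℝ) * (poch u r * poch v r * poch w (k - r) *
      poch (u + v + w + r) (k - r)) = poch (v + w) k * poch (u + w) k := by
  induction k with
  | zero => simp
  | succ k ih =>
    -- At `m = k` the right side is minus the term `r = k + 1` that the longer sum still lacks.
    have hp := saalschutz_partial u v w k k le_rfl
    rw [sum_sub_distrib, ← mul_sum, ih] at hp
    rw [sum_range_succ, poch_succ (v + w), poch_succ (u + w), eq_add_of_sub_eq hp]
    simp
    ring

theorem poch_reflect (x : ℝ) (k : ℕ) : poch x k = (-1) ^ k * poch (1 - x - k) k := by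
  have := poch_neg (-x) k
  rw [neg_neg] at this
  rw [this]; ring_nf

/-- This is `saalschutz` with third parameter `E - A - w`, after reflecting the factors that contain
it. The balance condition turns the reflected parameter into `F`, giving the usual terminating `₃F₂`
form without denominators. -/
theorem saalschutz_balanced (A w E F : ℝ) (M : ℕ) (hb : E + F = A + w - M + 1) :
    ∑ m ∈ range (M + 1), (-1) ^ m * (M.choose m : ℝ) * (poch A m * poch w m *
      poch (E + m) (M - m) * poch (F + m) (M - m)) = poch (E - A) M * poch (F - A) M := by
  have hs := saalschutz A w (E - A - w) M
  rw [show w + (E - A - w) = E - A by ring, show A + (E - A - w) = -(F - A + M - 1) by linarith,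
    poch_neg, show F - A + M - 1 - M + 1 = F - A by ring] at hs
  have h2 : ((-1 : ℝ) ^ M) * (-1) ^ M = 1 := by rw [← mul_pow]; simp
  rw [show poch (E - A) M * poch (F - A) M =
    (-1) ^ M * (poch (E - A) M * ((-1) ^ M * poch (F - A) M)) by
      linear_combination (- poch (E - A) M * poch (F - A) M) * h2, ← hs, mul_sum]
  refine sum_congr rfl fun m hm => ?_
  have hm : m ≤ M := by simpa [Nat.lt_succ_iff] using hm
  rw [poch_reflect (E - A - w) (M - m), Nat.cast_sub hm,
    show 1 - (E - A - w) - ((M : ℝ) - m) = F + m by linarith,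
    show A + w + (E - A - w) + m = E + m by ring]
  obtain ⟨p, rfl⟩ := Nat.exists_eq_add_of_le hm
  rw [Nat.add_sub_cancel_left]
  have h3 : ((-1 : ℝ) ^ p) * (-1) ^ p = 1 := by rw [← mul_pow]; simp
  rw [pow_add]
  linear_combination (-((-1) ^ m * ((m + p).choose m : ℝ) * poch A m * poch w m *
      poch (E + m) p * poch (F + m) p)) * h3

/-! ### The Sears–Whipple transformation -/

/-- Denominator-free form of the Sears–Whipple transformation of a terminating balanced `₄F₃`. -/
theorem sears_polynomial (a b c d e f : ℝ) (N : ℕ) (hb : d + e + f = a + b + c - N + 1) :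
    ∑ k ∈ range (N + 1), (-1) ^ k * (N.choose k : ℝ) * (poch a k * poch b k * poch c k *
      (poch (d + k) (N - k) * poch (e + k) (N - k) * poch (f + k) (N - k))) =
    ∑ r ∈ range (N + 1), (-1) ^ r * (N.choose r : ℝ) * (poch a r * poch (d - b) r *
      poch (d - c) r * (poch (d + r) (N - r) * poch (e - a) (N - r) * poch (f - a) (N - r))) := by
  let φ : ℕ → ℕ → ℝ := fun r m => ((-1) ^ r * (N.choose r : ℝ) * (poch a r * poch (d - b) r *
      poch (d - c) r * poch (d + r) (N - r))) * ((-1) ^ m * ((N - r).choose m : ℝ) *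
      (poch (a + r) m * poch (b + c - d) m *
      poch (e + r + m) (N - r - m) * poch (f + r + m) (N - r - m)))
  have key := sum_range_diag_flip (N + 1) φ
  trans ∑ m ∈ range (N + 1), ∑ k ∈ range (m + 1), φ k (m - k)
  · refine sum_congr rfl fun k hk => ?_
    have hk : k ≤ N := by simpa [Nat.lt_succ_iff] using hk
    -- These parameters expand the product `(b)_k (c)_k` as a sum over `r`. The total `u + v + w =
    -- d` merges with `(d + k)_(N-k)`, which makes the inner sum over `m = k - r` summable.
    have hs := saalschutz (d - b) (d - c) (b + c - d) k
    rw [show d - c + (b + c - d) = b by ring, show d - b + (b + c - d) = c by ring] at hs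
    rw [mul_assoc (poch a k), hs.symm, mul_sum, sum_mul, mul_sum]
    refine sum_congr rfl fun r hr => ?_
    have hr : r ≤ k := by simpa [Nat.lt_succ_iff] using hr
    obtain ⟨m, rfl⟩ := Nat.exists_eq_add_of_le hr
    obtain ⟨p, rfl⟩ := Nat.exists_eq_add_of_le hk
    have hc : ((r + m + p).choose (r + m) : ℝ) * ((r + m).choose r : ℝ) =
        ((r + m + p).choose r : ℝ) * ((m + p).choose m : ℝ) := by
      have := Nat.choose_mul (n := r + m + p) (k := r + m) (s := r) (by omega)
      rw [show r + m + p - r = m + p by omega, show r + m - r = m by omega] at this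
      exact_mod_cast this
    simp only [φ]
    rw [show r + m + p - r = m + p by omega, show r + m - r = m by omega,
      show r + m + p - (r + m) = p by omega, show m + p - m = p by omega,
      poch_add a r m, poch_add (d + r) m p,
      show d - b + (d - c) + (b + c - d) + r = d + r by ring]
    push_cast
    rw [← add_assoc d, ← add_assoc e, ← add_assoc f, pow_add]
    linear_combination ((-1) ^ r * (-1) ^ m * poch a r * poch (a + r) m * poch (d - b) r *
      poch (d - c) r * poch (b + c - d) m * poch (d + r) m * poch (d + r + m) p *
      poch (e + r + m) p * poch (f + r + m) p) * hc
  · rw [key]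
    refine sum_congr rfl fun r hr => ?_
    have hr : r ≤ N := by simpa [Nat.lt_succ_iff] using hr
    simp only [φ]
    rw [← mul_sum, show N + 1 - r = N - r + 1 by omega,
      saalschutz_balanced (a + r) (b + c - d) (e + r) (f + r) (N - r)
        (by rw [Nat.cast_sub hr]; linarith)]
    rw [show e + r - (a + r) = e - a by ring, show f + r - (a + r) = f - a by ring]
    ring

/-- The terminating series `₄F₃(-N, a, b, c; d, e, f; 1)`. -/
noncomputable def hyperSum (N : ℕ) (a b c d e f : ℝ) : ℝ :=
  ∑ k ∈ range (N + 1), poch (-(N : ℝ)) k * poch a k * poch b k * poch c k /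
    (poch d k * poch e k * poch f k * poch 1 k)

theorem poch_ne_zero_of_le {a : ℝ} {k N : ℕ} (hk : k ≤ N) (ha : poch a N ≠ 0) : poch a k ≠ 0 := by
  rw [poch_eq_mul_of_le a hk] at ha
  exact left_ne_zero_of_mul ha

/-- The Sears–Whipple transformation of a terminating balanced `₄F₃`. -/
theorem hyperSum_sears (a b c d e f : ℝ) (N : ℕ) (hb : d + e + f = a + b + c - N + 1)
    (hd : poch d N ≠ 0) (he : poch e N ≠ 0) (hf : poch f N ≠ 0)
    (hea : poch (e - a) N ≠ 0) (hfa : poch (f - a) N ≠ 0) :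
    hyperSum N a b c d e f = poch (e - a) N * poch (f - a) N / (poch e N * poch f N) *
      hyperSum N a (d - b) (d - c) d (1 - N - (e - a)) (1 - N - (f - a)) := by
  have h1 : poch d N * poch e N * poch f N * hyperSum N a b c d e f =
      ∑ k ∈ range (N + 1), (-1) ^ k * (N.choose k : ℝ) * (poch a k * poch b k * poch c k *
      (poch (d + k) (N - k) * poch (e + k) (N - k) * poch (f + k) (N - k))) := by
    rw [hyperSum, mul_sum]
    refine sum_congr rfl fun k hk => ?_
    have hk : k ≤ N := by simpa [Nat.lt_succ_iff] using hk
    rw [neg_one_pow_mul_choose_eq_poch hk]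
    have hd' := poch_ne_zero_of_le hk hd
    have he' := poch_ne_zero_of_le hk he
    have hf' := poch_ne_zero_of_le hk hf
    have h1' := (poch_pos one_pos k).ne'
    rw [poch_eq_mul_of_le d hk, poch_eq_mul_of_le e hk, poch_eq_mul_of_le f hk]
    field_simp
  -- Reversing `(x)_(N-k)` is what turns `e - a` and `f - a` into the lower parameters `1 - N - (e -
  -- a)` and `1 - N - (f - a)`.
  have hrefl : ∀ x : ℝ, ∀ k ≤ N, poch x N = (-1) ^ k * poch (1 - N - x) k * poch x (N - k) := by
    intro x k hk
    have : poch x N = poch x (N - k + k) := by rw [Nat.sub_add_cancel hk]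
    rw [this, poch_add, poch_reflect (x + (N - k : ℕ)) k, Nat.cast_sub hk,
      show 1 - (x + ((N : ℝ) - k)) - k = 1 - N - x by ring]
    ring
  have h2 : poch d N * poch (e - a) N * poch (f - a) N *
      hyperSum N a (d - b) (d - c) d (1 - N - (e - a)) (1 - N - (f - a)) =
      ∑ r ∈ range (N + 1), (-1) ^ r * (N.choose r : ℝ) * (poch a r * poch (d - b) r *
      poch (d - c) r * (poch (d + r) (N - r) * poch (e - a) (N - r) * poch (f - a) (N - r))) := by
    rw [hyperSum, mul_sum]
    refine sum_congr rfl fun k hk => ?_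
    have hk : k ≤ N := by simpa [Nat.lt_succ_iff] using hk
    rw [neg_one_pow_mul_choose_eq_poch hk]
    have hd' := poch_ne_zero_of_le hk hd
    have he' := hrefl (e - a) k hk
    have hf' := hrefl (f - a) k hk
    have he2 : poch (1 - N - (e - a)) k ≠ 0 := fun h0 => hea (by rw [he', h0]; simp)
    have hf2 : poch (1 - N - (f - a)) k ≠ 0 := fun h0 => hfa (by rw [hf', h0]; simp)
    have h1' := (poch_pos one_pos k).ne'
    have hs : ((-1 : ℝ) ^ k) * (-1) ^ k = 1 := by rw [← mul_pow]; simp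
    rw [poch_eq_mul_of_le d hk, he', hf']
    field_simp
    rw [show ((-1 : ℝ) ^ k) ^ 2 = 1 by rw [sq, hs]]
    ring
  rw [sears_polynomial a b c d e f N hb, ← h2] at h1
  apply mul_left_cancel₀ (mul_ne_zero (mul_ne_zero hd he) hf)
  rw [h1]
  field_simp

/-! ### Legendre moments -/

theorem continuous_aeval_shiftedLegendre (c : ℕ) :
    Continuous fun t : ℝ => Polynomial.aeval t (Polynomial.shiftedLegendre c) :=
  Polynomial.continuous_aeval _

/-- Termwise integration gives a multiple of `₃F₂(-c, c+1, k+1; 1, k+2; 1)`, which is balanced. -/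
theorem integral_pow_mul_shiftedLegendre (k c : ℕ) :
    ∫ t in (0 : ℝ)..1, t ^ k * Polynomial.aeval (1 - t) (Polynomial.shiftedLegendre c) =
      poch (k + 1 - c) c / poch (k + 1) (c + 1) := by
  have h1 : ∀ t : ℝ, t ^ k * Polynomial.aeval (1 - t) (Polynomial.shiftedLegendre c) =
      ∑ m ∈ range (c + 1), (-1) ^ c * ((-1) ^ m * (c.choose m : ℝ) * ((c + m).choose c : ℝ)) *
        t ^ (k + m) := by
    intro t
    rw [Polynomial.shiftedLegendre_eval_symm, sub_sub_cancel, Polynomial.shiftedLegendre,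
      map_sum, mul_sum, mul_sum]
    refine sum_congr rfl fun m _ => ?_
    simp [pow_add]
    ring
  simp_rw [h1]
  rw [intervalIntegral.integral_finsetSum fun m _ =>
    (Continuous.intervalIntegrable (by fun_prop) _ _)]
  simp_rw [intervalIntegral.integral_const_mul, integral_pow]
  have hs := saalschutz_balanced (c + 1) (k + 1) 1 (k + 2) c (by ring)
  have hpos : 0 < poch ((k : ℝ) + 1) (c + 1) := poch_pos (by positivity) _
  have hterm : ∀ m ∈ range (c + 1), (-1) ^ m * (c.choose m : ℝ) * (poch (c + 1) m *
      poch (k + 1) m * poch (1 + m) (c - m) * poch (k + 2 + m) (c - m)) =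
      (c.factorial * poch (k + 1) (c + 1)) * ((-1) ^ m * (c.choose m : ℝ) *
        ((c + m).choose c : ℝ) * (1 / ((k + m : ℕ) + 1))) := by
    intro m hm
    have hm : m ≤ c := by simpa [Nat.lt_succ_iff] using hm
    have e1 : poch ((k : ℝ) + 1) (c + 1) =
        poch (k + 1) m * (k + 1 + m) * poch (k + 2 + m) (c - m) := by
      rw [poch_eq_mul_of_le _ (show m + 1 ≤ c + 1 by omega), poch_succ,
        show c + 1 - (m + 1) = c - m by omega]
      push_cast
      rw [show (k : ℝ) + 1 + (m + 1) = k + 2 + m by ring]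
    have e2 : poch ((c : ℝ) + 1) m * poch (1 + m) (c - m) =
        c.factorial * ((c + m).choose c : ℝ) := by
      have f1 := factorial_mul_poch c m
      have f2 := factorial_mul_poch m (c - m)
      have f3 : ((c + m).choose c : ℝ) * c.factorial * m.factorial = (c + m).factorial := by
        have := Nat.choose_mul_factorial_mul_factorial (Nat.le_add_right c m)
        rw [Nat.add_sub_cancel_left] at this
        exact_mod_cast this
      rw [Nat.add_sub_cancel' hm, add_comm (m : ℝ)] at f2
      have : (c.factorial : ℝ) * m.factorial ≠ 0 := by positivity
      apply mul_left_cancel₀ this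
      rw [show (c.factorial : ℝ) * m.factorial * (poch (c + 1) m * poch (1 + m) (c - m)) =
        (c.factorial * poch (c + 1) m) * (m.factorial * poch (1 + m) (c - m)) by ring, f1, f2, ← f3]
      ring
    have hne : (k : ℝ) + m + 1 ≠ 0 := by positivity
    rw [e1]
    push_cast
    field_simp
    linear_combination ((k : ℝ) + m + 1) * poch (k + 2 + m) (c - m) * (c.choose m : ℝ) *
      poch (k + 1) m * e2
  rw [sum_congr rfl hterm, ← mul_sum] at hs
  have h2 : poch (1 - ((c : ℝ) + 1)) c = (-1) ^ c * c.factorial := by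
    rw [show 1 - ((c : ℝ) + 1) = -c by ring, poch_neg, show (c : ℝ) - c + 1 = 1 by ring, poch_one]
  rw [h2, show (k : ℝ) + 2 - (c + 1) = k + 1 - c by ring] at hs
  rw [eq_div_iff hpos.ne']
  have hc : (c.factorial : ℝ) ≠ 0 := by positivity
  apply mul_left_cancel₀ hc
  have h3 : ((-1 : ℝ) ^ c) * (-1) ^ c = 1 := by rw [← mul_pow]; simp
  rw [show (c.factorial : ℝ) * poch (k + 1 - c) c =
    (-1) ^ c * ((-1) ^ c * c.factorial * poch (k + 1 - c) c) by
      linear_combination (-(c.factorial : ℝ) * poch (k + 1 - c) c) * h3, ← hs, mul_sum, sum_mul,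
      mul_sum, mul_sum]
  refine sum_congr rfl fun m _ => ?_
  simp
  ring

/-! ### Matrix entries as finite sums -/

theorem legendre_two_mul_sub_one (c : ℕ) (t : ℝ) :
    legendre c (2 * t - 1) =
      √(2 * (c : ℝ) + 1) / √2 * Polynomial.aeval (1 - t) (Polynomial.shiftedLegendre c) := by
  rw [legendre, show (1 - (2 * t - 1)) / 2 = 1 - t by ring]

theorem D1_apply (n : ℕ) (r c : Fin (n + 1)) :
    D1 n r c = √2 * √(2 * ((c : ℕ) : ℝ) + 1) * ∫ t in (0 : ℝ)..1,
      hPoly n (n - r) t * Polynomial.aeval (1 - t) (Polynomial.shiftedLegendre c) := by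
  have h2 : (2 : ℝ) / √2 = √2 := Real.div_sqrt
  have hI : ∫ t in (0 : ℝ)..1, psi n r ((t + 1) / 2) * legendre c (2 * t - 1) =
      ∫ t in (0 : ℝ)..1, √(2 * ((c : ℕ) : ℝ) + 1) / √2 * (hPoly n (n - r) t *
        Polynomial.aeval (1 - t) (Polynomial.shiftedLegendre c)) := by
    refine intervalIntegral.integral_congr_ae ?_
    -- The wavelet is cut off at `t = 1`, so the integrands agree only almost everywhere.
    have h1 : ∀ᵐ t : ℝ, t ≠ 1 := by simp [MeasureTheory.ae_iff]
    filter_upwards [h1] with t ht ht'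
    rw [Set.uIoc_of_le zero_le_one] at ht'
    have hlt : t < 1 := lt_of_le_of_ne ht'.2 ht
    have hmem : (t + 1) / 2 ∈ Set.Ico (0 : ℝ) 1 := ⟨by linarith [ht'.1], by linarith⟩
    rw [legendre_two_mul_sub_one, psi, Set.indicator_of_mem hmem,
      show 2 * ((t + 1) / 2) - 1 = t by ring, h, if_pos ⟨ht'.1.le, hlt⟩]
    ring
  rw [D1, Matrix.of_apply, hI, intervalIntegral.integral_const_mul, ← mul_assoc,
    show 2 * (√(2 * ((c : ℕ) : ℝ) + 1) / √2) = 2 / √2 * √(2 * ((c : ℕ) : ℝ) + 1) by ring, h2]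

theorem integral_sum_pow_mul_shiftedLegendre (d : ℕ → ℝ) (K c : ℕ) :
    ∫ t in (0 : ℝ)..1, (∑ k ∈ range K, d k * t ^ k) *
        Polynomial.aeval (1 - t) (Polynomial.shiftedLegendre c) =
      ∑ k ∈ range K, d k * (poch (k + 1 - c) c / poch (k + 1) (c + 1)) := by
  have hc : Continuous fun t : ℝ => Polynomial.aeval (1 - t) (Polynomial.shiftedLegendre c) :=
    (continuous_aeval_shiftedLegendre c).comp (by fun_prop)
  simp_rw [sum_mul, mul_assoc]
  rw [intervalIntegral.integral_finsetSum fun m _ =>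
    (Continuous.intervalIntegrable (by fun_prop) _ _)]
  simp_rw [intervalIntegral.integral_const_mul, integral_pow_mul_shiftedLegendre]

/-- Orthogonality to lower powers: the rising factorial starts at a nonpositive integer and passes
through zero. -/
theorem moment_eq_zero {k c : ℕ} (hk : k < c) : poch ((k : ℝ) + 1 - c) c = 0 := by
  obtain ⟨p, rfl⟩ := Nat.exists_eq_add_of_lt hk
  rw [show (k : ℝ) + 1 - (k + p + 1 : ℕ) = -(p : ℝ) by push_cast; ring]
  exact poch_neg_natCast_eq_zero (by omega)

theorem hPoly_even {n i : ℕ} (hi : Even i) (hi0 : 0 < i) (hin : i ≤ n) (t : ℝ) :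
    hPoly n i t = hPoly (n - 1) (i - 1) t := by
  have h1 : ¬(i = 0 ∨ Odd i) := by
    rw [Nat.not_even_iff_odd.symm]; rintro (h | h) <;> [omega; exact h hi]
  have h2 : Odd (i - 1) := Nat.Even.sub_odd hi0 hi odd_one
  rw [hPoly, hPoly, if_neg h1, if_pos (Or.inr h2), Nat.sub_add_cancel (by omega)]

theorem D1_even_eq {n i j : ℕ} (hi : Even i) (hi0 : 0 < i) (hin : i ≤ n)
    (hr : n - i < n + 1) (hc : n - j < n + 1) (hr' : n - i < n - 1 + 1)
    (hc' : n - j < n - 1 + 1) :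
    D1 n ⟨n - i, hr⟩ ⟨n - j, hc⟩ = D1 (n - 1) ⟨n - i, hr'⟩ ⟨n - j, hc'⟩ := by
  rw [D1_apply, D1_apply]
  simp only [Nat.sub_sub_self hin, show n - 1 - (n - i) = i - 1 by omega, hPoly_even hi hi0 hin]

theorem D1_even_zero {n i : ℕ} (hi : Even i) (hi0 : 0 < i) (hin : i ≤ n)
    (hr : n - i < n + 1) (hc : n < n + 1) :
    D1 n ⟨n - i, hr⟩ ⟨n, hc⟩ = 0 := by
  have h1 : ¬(i = 0 ∨ Odd i) := by
    rw [Nat.not_even_iff_odd.symm]; rintro (h | h) <;> [omega; exact h hi]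
  rw [D1_apply]
  simp only [Nat.sub_sub_self hin, hPoly, if_neg h1]
  rw [integral_sum_pow_mul_shiftedLegendre, sum_eq_zero, mul_zero]
  intro k hk
  rw [moment_eq_zero (mem_range.1 hk)]
  simp

theorem D1_odd_eq_sum {n i j : ℕ} (hi : Odd i) (hin : i ≤ n)
    (hr : n - i < n + 1) (hc : n - j < n + 1) :
    D1 n ⟨n - i, hr⟩ ⟨n - j, hc⟩ = √2 * √(2 * ((n - j : ℕ) : ℝ) + 1) *
      ∑ k ∈ range (n + 1), coeffD n i k *
        (poch (k + 1 - (n - j : ℕ)) (n - j) / poch (k + 1) (n - j + 1)) := by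
  rw [D1_apply]
  simp only [Nat.sub_sub_self hin, hPoly, if_pos (Or.inr hi)]
  rw [integral_sum_pow_mul_shiftedLegendre]

theorem poch_sub_add_one {k c : ℕ} (hc : c ≤ k) :
    ((k - c).factorial : ℝ) * poch ((k : ℝ) + 1 - c) c = k.factorial := by
  have := factorial_mul_poch (k - c) c
  rwa [Nat.cast_sub hc, Nat.sub_add_cancel hc, show (k : ℝ) - c + 1 = k + 1 - c by ring] at this

/-- The index `l = n - k` counts down from the top power; each rising factorial becomes a quotient
of factorials, leaving a form whose term ratio is easy to read. -/
theorem coeffD_mul_moment {n q j l : ℕ} (hin : 2 * q + 1 ≤ n) (hl : l ≤ j) (hj : j ≤ n) :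
    coeffD n (2 * q + 1) (n - l) *
        (poch ((n - l : ℕ) + 1 - (n - j : ℕ)) (n - j) / poch ((n - l : ℕ) + 1) (n - j + 1)) =
      (-1) ^ (l + 1) * √(2 * (n - (2 * q + 1 : ℕ)) + 1) *
        ((2 * n - (2 * q + 1) - l).factorial / (l.factorial * (j - l).factorial *
          (2 * n - l - j + 1).factorial) *
        (∏ m ∈ range (q + 1), (2 * (n : ℝ) + 1 - l - 2 * m)) *
        ∏ m ∈ range q, ((l : ℝ) - 1 - 2 * m)) := by
  have a1 := factorial_mul_poch_neg (N := n) (k := n - l) (by omega)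
  have a2 := factorial_mul_poch_neg (N := n) (k := 2 * q + 1) hin
  have a3 := factorial_mul_poch (n - (2 * q + 1)) (n - l)
  have a4 := poch_sub_add_one (k := n - l) (c := n - j) (by omega)
  have a5 := factorial_mul_poch (n - l) (n - j + 1)
  rw [show n - (n - l) = l by omega] at a1
  rw [Nat.cast_sub hin, show n - (2 * q + 1) + (n - l) = 2 * n - (2 * q + 1) - l by omega] at a3
  rw [show n - l - (n - j) = j - l by omega] at a4
  rw [show n - l + (n - j + 1) = 2 * n - l - j + 1 by omega] at a5
  have f1 : (l.factorial : ℝ) ≠ 0 := by positivity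
  have f2 : ((n - (2 * q + 1)).factorial : ℝ) ≠ 0 := by positivity
  have f3 : ((j - l).factorial : ℝ) ≠ 0 := by positivity
  have f4 : ((n - l).factorial : ℝ) ≠ 0 := by positivity
  have f5 : (n.factorial : ℝ) ≠ 0 := by positivity
  have f6 : ((2 * n - l - j + 1).factorial : ℝ) ≠ 0 := by positivity
  rw [mul_comm, ← eq_div_iff f1] at a1
  rw [mul_comm, ← eq_div_iff f2] at a2
  rw [mul_comm, ← eq_div_iff f2] at a3
  rw [mul_comm, ← eq_div_iff f3] at a4
  rw [mul_comm, ← eq_div_iff f4] at a5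
  rw [coeffD, a1, a2, a3, a4, a5, poch_one,
    show (2 * q + 1 + 1) / 2 = q + 1 by omega, show (2 * q + 1 - 1) / 2 = q by omega,
    show 2 * (n : ℝ) - 2 * (2 * q + 1 : ℕ) + 1 = 2 * (n - (2 * q + 1 : ℕ)) + 1 by ring]
  have p1 : ∏ m ∈ range (q + 1), ((n : ℝ) + (n - l : ℕ) + 1 - 2 * m) =
      ∏ m ∈ range (q + 1), (2 * (n : ℝ) + 1 - l - 2 * m) :=
    prod_congr rfl fun m _ => by rw [Nat.cast_sub (by omega)]; ring
  have p2 : ∏ m ∈ range q, ((n : ℝ) - (n - l : ℕ) - 1 - 2 * m) =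
      ∏ m ∈ range q, ((l : ℝ) - 1 - 2 * m) :=
    prod_congr rfl fun m _ => by rw [Nat.cast_sub (by omega)]; ring
  rw [p1, p2]
  have s1 : (-1 : ℝ) ^ n * (-1) ^ (n - l) = (-1) ^ l := by
    obtain ⟨k, rfl⟩ := Nat.exists_eq_add_of_le (hl.trans hj)
    rw [Nat.add_sub_cancel_left, pow_add, mul_assoc, ← mul_pow]; simp
  have s2 : (-1 : ℝ) ^ (2 * q + 1) = -1 := by rw [pow_succ, pow_mul]; simp
  rw [s2, pow_succ, ← s1]
  field_simp

theorem prod_odd_eq_zero {q l : ℕ} (hl : Odd l) (hlq : l < 2 * q) :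
    ∏ m ∈ range q, ((l : ℝ) - 1 - 2 * m) = 0 := by
  obtain ⟨s, rfl⟩ := hl
  exact prod_eq_zero (i := s) (mem_range.2 (by omega)) (by push_cast; ring)

/-- The summand of a matrix entry in an odd row, up to factors independent of `s`. -/
noncomputable def entryTerm (n q j s : ℕ) : ℝ :=
  (2 * n - (2 * q + 1) - 2 * s).factorial / ((2 * s).factorial * (j - 2 * s).factorial *
    (2 * n - 2 * s - j + 1).factorial) *
  (∏ m ∈ range (q + 1), (2 * (n : ℝ) + 1 - 2 * s - 2 * m)) * ∏ m ∈ range q, (2 * (s : ℝ) - 1 - 2 * m)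

theorem D1_odd_eq_sum_entryTerm {n q j : ℕ} (hin : 2 * q + 1 ≤ n) (hj : j < 2 * q + 1)
    (hr : n - (2 * q + 1) < n + 1) (hc : n - j < n + 1) :
    D1 n ⟨n - (2 * q + 1), hr⟩ ⟨n - j, hc⟩ =
      √2 * √(2 * (n - (2 * q + 1 : ℕ)) + 1) * √(2 * ((n : ℝ) - j) + 1) *
        (-∑ s ∈ range (j / 2 + 1), entryTerm n q j s) := by
  rw [D1_odd_eq_sum (by simp) hin, ← sum_range_reflect]
  have hsum : ∑ k ∈ range (n + 1), coeffD n (2 * q + 1) (n + 1 - 1 - k) *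
        (poch ((n + 1 - 1 - k : ℕ) + 1 - (n - j : ℕ)) (n - j) /
          poch ((n + 1 - 1 - k : ℕ) + 1) (n - j + 1)) =
      ∑ s ∈ range (j / 2 + 1), -√(2 * (n - (2 * q + 1 : ℕ)) + 1) * entryTerm n q j s := by
    symm
    -- Only `l = 2s` with `2s ≤ j` contributes: moments vanish for `l > j`, and an odd `l ≤ j < 2q +
    -- 1` satisfies `l < 2q`, so its product contains a zero factor.
    refine sum_of_injOn (fun s => 2 * s) (fun a _ b _ hab => by simpa using hab) ?_ ?_ ?_
    · intro s hs
      simp at hs ⊢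
      omega
    · intro l hl hl'
      have hl : l ≤ n := by simpa [Nat.lt_succ_iff] using hl
      rw [Nat.add_sub_cancel]
      rcases lt_or_ge j l with hjl | hlj
      · rw [moment_eq_zero (by omega)]; simp
      · have hodd : Odd l := by
          rw [← Nat.not_even_iff_odd]
          rintro ⟨s, rfl⟩
          exact hl' ⟨s, by simp; omega, by simp; omega⟩
        rw [coeffD_mul_moment hin hlj (by omega), prod_odd_eq_zero hodd (by
          obtain ⟨s, rfl⟩ := hodd; omega)]
        simp
    · intro s hs
      have hs : s ≤ j / 2 := by simpa [Nat.lt_succ_iff] using hs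
      rw [Nat.add_sub_cancel, coeffD_mul_moment hin (by omega) (by omega), entryTerm]
      rw [pow_succ, pow_mul]
      push_cast
      simp
  rw [hsum, ← mul_sum, Nat.cast_sub (by omega)]
  ring

/-! ### The entry sum as a balanced `₄F₃` -/

theorem prod_sub_two_mul_shift (x : ℝ) (q : ℕ) :
    (∏ m ∈ range q, (x - 2 - 2 * m)) * x = (∏ m ∈ range q, (x - 2 * m)) * (x - 2 * q) := by
  have h1 := prod_range_succ (fun m : ℕ => x - 2 * (m : ℝ)) q
  have h2 := prod_range_succ' (fun m : ℕ => x - 2 * (m : ℝ)) q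
  rw [← h1, h2]
  congr 1
  · exact prod_congr rfl fun m _ => by push_cast; ring
  · simp

/-- Passing from `s` to `s + 1` changes each factorial by two consecutive factors and shifts each
product by one step. The new end factors of the products cancel one factor from the top factorial
and one from `(2s + 2)!`; the rest is the ratio of a `₄F₃`. -/
theorem entryTerm_succ {n q N ε s : ℕ} (hε : ε ≤ 1) (hs : s < N) (hN : N + ε ≤ q)
    (hin : 2 * q + 1 ≤ n) :
    entryTerm n q (2 * N + ε) (s + 1) *
        ((1 / 2 - q + s) * (-(n : ℝ) - 1 / 2 + s) * (-n + q + 1 + s) * (1 + s)) =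
      entryTerm n q (2 * N + ε) s *
        ((-N + s) * (-(n : ℝ) + N + s) * (1 / 2 - N - ε + s) * (-n + N - 1 / 2 + ε + s)) := by
  obtain ⟨p, rfl⟩ := Nat.exists_eq_add_of_lt hs
  obtain ⟨x, rfl⟩ := Nat.exists_eq_add_of_le hN
  obtain ⟨t, rfl⟩ := Nat.exists_eq_add_of_le hin
  have hP1 := prod_sub_two_mul_shift
    (2 * ((2 * (s + p + 1 + ε + x) + 1 + t : ℕ) : ℝ) + 1 - 2 * s) (s + p + 1 + ε + x + 1)
  have hP2 := prod_sub_two_mul_shift (2 * ((s + 1 : ℕ) : ℝ) - 1) (s + p + 1 + ε + x)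
  rw [show (2 * ((s + 1 : ℕ) : ℝ) - 1 - 2) = 2 * (s : ℝ) - 1 by push_cast; ring] at hP2
  rw [show (2 * ((2 * (s + p + 1 + ε + x) + 1 + t : ℕ) : ℝ) + 1 - 2 * s - 2) =
    2 * ((2 * (s + p + 1 + ε + x) + 1 + t : ℕ) : ℝ) + 1 - 2 * ((s + 1 : ℕ) : ℝ) by
      push_cast; ring] at hP1
  rw [entryTerm, entryTerm]
  generalize (∏ m ∈ range (s + p + 1 + ε + x + 1),
    (2 * ((2 * (s + p + 1 + ε + x) + 1 + t : ℕ) : ℝ) + 1 - 2 * s - 2 * m)) = A at *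
  generalize (∏ m ∈ range (s + p + 1 + ε + x + 1),
    (2 * ((2 * (s + p + 1 + ε + x) + 1 + t : ℕ) : ℝ) + 1 - 2 * ((s + 1 : ℕ) : ℝ) - 2 * m)) = B at *
  generalize (∏ m ∈ range (s + p + 1 + ε + x), (2 * (s : ℝ) - 1 - 2 * m)) = C at *
  generalize (∏ m ∈ range (s + p + 1 + ε + x), (2 * ((s + 1 : ℕ) : ℝ) - 1 - 2 * m)) = D at *
  have hA : A * (2 * (p + 1 + ε + x) + 2 * t + 1 : ℝ) =
      B * (2 * ((2 * (s + p + 1 + ε + x) + 1 + t : ℕ) : ℝ) + 1 - 2 * s) := by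
    rw [hP1]; push_cast; ring
  have hC : D * (2 * ((s + 1 : ℕ) : ℝ) - 1 - 2 * ((s + p + 1 + ε + x : ℕ) : ℝ)) = C * (2 * s + 1) := by
    rw [← hP2]; push_cast; ring
  have g1 : 2 * (2 * (s + p + 1 + ε + x) + 1 + t) - (2 * (s + p + 1 + ε + x) + 1) - 2 * s =
    2 * (p + ε + x + t) + 1 + 1 + 1 := by omega
  have g2 : 2 * (2 * (s + p + 1 + ε + x) + 1 + t) - (2 * (s + p + 1 + ε + x) + 1) - 2 * (s + 1) =
    2 * (p + ε + x + t) + 1 := by omega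
  have g3 : 2 * (s + p + 1) + ε - 2 * s = 2 * p + ε + 1 + 1 := by omega
  have g4 : 2 * (s + p + 1) + ε - 2 * (s + 1) = 2 * p + ε := by omega
  have g5 : 2 * (2 * (s + p + 1 + ε + x) + 1 + t) - 2 * s - (2 * (s + p + 1) + ε) + 1 =
    2 * p + 3 * ε + 4 * x + 2 * t + 3 + 1 + 1 := by omega
  have g6 : 2 * (2 * (s + p + 1 + ε + x) + 1 + t) - 2 * (s + 1) - (2 * (s + p + 1) + ε) + 1 =
    2 * p + 3 * ε + 4 * x + 2 * t + 3 := by omega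
  rw [g1, g2, g3, g4, g5, g6, show 2 * (s + 1) = 2 * s + 1 + 1 by ring]
  simp only [Nat.factorial_succ (2 * (p + ε + x + t) + 1 + 1),
    Nat.factorial_succ (2 * (p + ε + x + t) + 1),
    Nat.factorial_succ (2 * s + 1), Nat.factorial_succ (2 * s), Nat.factorial_succ (2 * p + ε),
    Nat.factorial_succ (2 * p + ε + 1),
    Nat.factorial_succ (2 * p + 3 * ε + 4 * x + 2 * t + 3),
    Nat.factorial_succ (2 * p + 3 * ε + 4 * x + 2 * t + 3 + 1)]
  push_cast at hA hC ⊢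
  have n1 : (2 * (p + 1 + ε + x) + 2 * t + 1 : ℝ) ≠ 0 := by positivity
  have n2 : (2 * (s : ℝ) + 1) ≠ 0 := by positivity
  rw [← eq_div_iff n1] at hA
  rw [eq_comm, ← eq_div_iff n2] at hC
  rw [hA, hC]
  have f1 : ((2 * (p + ε + x + t) + 1).factorial : ℝ) ≠ 0 := by positivity
  have f2 : ((2 * s).factorial : ℝ) ≠ 0 := by positivity
  have f3 : ((2 * p + ε).factorial : ℝ) ≠ 0 := by positivity
  have f4 : ((2 * p + 3 * ε + 4 * x + 2 * t + 3).factorial : ℝ) ≠ 0 := by positivity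
  -- Which of two consecutive factors is even depends on the parity of `j`, so the uniform right
  -- side is an identity only for `ε = 0` and `ε = 1`.
  interval_cases ε
  · field_simp
    ring
  · field_simp
    ring

theorem half_int_ne_zero (m : ℤ) : (1 / 2 : ℝ) + m ≠ 0 := by
  intro h0
  have : (2 * m + 1 : ℤ) = 0 := by
    have : (2 * m + 1 : ℝ) = 0 := by linarith
    exact_mod_cast this
  omega

theorem poch_half_int_ne_zero {x : ℝ} (m : ℤ) (hx : x = 1 / 2 + m) (k : ℕ) : poch x k ≠ 0 := by
  refine poch_ne_zero fun r _ => ?_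
  have := half_int_ne_zero (m + r)
  push_cast at this
  rwa [hx, add_assoc]

theorem entryTerm_eq {n q N ε s : ℕ} (hε : ε ≤ 1) (hs : s ≤ N) (hN : N + ε ≤ q)
    (hin : 2 * q + 1 ≤ n) :
    entryTerm n q (2 * N + ε) s = entryTerm n q (2 * N + ε) 0 *
      (poch (-(N : ℝ)) s * poch (-n + N) s * poch (1 / 2 - N - ε) s * poch (-n + N - 1 / 2 + ε) s /
        (poch (1 / 2 - q) s * poch (-n - 1 / 2) s * poch (-n + q + 1) s * poch 1 s)) := by
  induction s with
  | zero => simp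
  | succ s ih =>
    have hd : (1 / 2 - q + s : ℝ) ≠ 0 := by
      have := half_int_ne_zero (s - q)
      push_cast at this
      intro h0; apply this; linarith
    have he : (-(n : ℝ) - 1 / 2 + s) ≠ 0 := by
      have := half_int_ne_zero (s - n - 1)
      push_cast at this
      intro h0; apply this; linarith
    have hf : (-(n : ℝ) + q + 1 + s) ≠ 0 := by
      have : (s : ℝ) + 1 + q + 1 ≤ n := by exact_mod_cast (by omega : s + 1 + q + 1 ≤ n)
      linarith
    have h1 : (1 + s : ℝ) ≠ 0 := by positivity
    have key := entryTerm_succ hε (show s < N by omega) hN hin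
    rw [ih (by omega)] at key
    have hne := mul_ne_zero (mul_ne_zero (mul_ne_zero hd he) hf) h1
    rw [eq_div_of_mul_eq hne key]
    simp only [poch_succ]
    have aux : ∀ E X Y Z W : ℝ, E * (X / Y) * Z / W = E * ((X * Z) / (Y * W)) := by
      intro E X Y Z W
      rw [mul_assoc, div_mul_eq_mul_div, mul_div_assoc, div_div]
    rw [aux]
    congr 2 <;> ring

/-! ### Transformation to the final series and its constant -/

theorem hyperSum_swap_fst (N : ℕ) (a b c d e f : ℝ) :
    hyperSum N a b c d e f = hyperSum N b a c e d f :=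
  sum_congr rfl fun k _ => by ring

theorem hyperSum_swap_lower (N : ℕ) (a b c d e f : ℝ) :
    hyperSum N a b c d e f = hyperSum N a b c f e d :=
  sum_congr rfl fun k _ => by ring

/-- The first transformation holds `-n + N` fixed and creates the upper parameter `N - q + ε`; the
second holds that one fixed, with `3/2` as distinguished lower parameter. Half-integrality or sign
keeps every denominator nonzero. -/
theorem hyperSum_two_step {n q N ε : ℕ} (hN : N + ε ≤ q) (hin : 2 * q + 1 ≤ n) :
    hyperSum N (-n + N) (1 / 2 - N - ε) (-n + N - 1 / 2 + ε) (1 / 2 - q) (-n - 1 / 2) (-n + q + 1) =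
      poch (-(1 / 2) - N) N * poch (q + 1 - N) N / (poch (-n - 1 / 2) N * poch (-n + q + 1) N) *
      (poch (1 / 2 - N - ε) N * poch (-N - ε) N / (poch (1 / 2 - q) N * poch (-q) N)) *
      hyperSum N (N - q + ε) (n + 3 / 2 - N) (-n + q + 1 / 2 + N + ε) (1 + ε) (1 / 2 + ε) (3 / 2) := by
  have hNq : (N : ℝ) + ε ≤ q := by exact_mod_cast hN
  have hqn : 2 * (q : ℝ) + 1 ≤ n := by exact_mod_cast hin
  have hε0 : (0 : ℝ) ≤ ε := by positivity
  have hlt : ∀ m < N, (m : ℝ) + 1 ≤ N := fun m hm => by exact_mod_cast hm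
  rw [hyperSum_sears _ _ _ _ _ _ N (by ring)
    (poch_half_int_ne_zero (-q) (by push_cast; ring) N)
    (poch_half_int_ne_zero (-n - 1) (by push_cast; ring) N)
    (poch_ne_zero fun m hm => by linarith [hlt m hm])
    (poch_half_int_ne_zero (-N - 1) (by push_cast; ring) N)
    (poch_ne_zero fun m hm => by
      have : (0 : ℝ) ≤ m := by positivity
      linarith [hlt m hm])]
  rw [show (-(n : ℝ) - 1 / 2 - (-n + N)) = -(1 / 2) - N by ring,
    show (-(n : ℝ) + q + 1 - (-n + N)) = q + 1 - N by ring,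
    show 1 - (N : ℝ) - (-(1 / 2) - N) = 3 / 2 by ring,
    show 1 - (N : ℝ) - (q + 1 - N) = -q by ring,
    show 1 / 2 - (q : ℝ) - (1 / 2 - N - ε) = N - q + ε by ring,
    show 1 / 2 - (q : ℝ) - (-n + N - 1 / 2 + ε) = n - N + 1 - q - ε by ring, hyperSum_swap_fst]
  have ha : (1 / 2 - (q : ℝ) - (N - q + ε)) = 1 / 2 - N - ε := by ring
  have hb : -(q : ℝ) - (N - q + ε) = -N - ε := by ring
  rw [hyperSum_sears (N - q + ε) _ _ _ _ _ N (by ring)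
    (poch_half_int_ne_zero 1 (by norm_num) N)
    (poch_half_int_ne_zero (-q) (by push_cast; ring) N)
    (poch_ne_zero fun m hm => by linarith [hlt m hm])
    (poch_half_int_ne_zero (-N - ε) (by push_cast; ring) N)
    (poch_ne_zero fun m hm => by linarith [hlt m hm]), ha, hb,
    show 1 - (N : ℝ) - (1 / 2 - N - ε) = 1 / 2 + ε by ring,
    show 1 - (N : ℝ) - (-N - ε) = 1 + ε by ring,
    show 3 / 2 - (-(n : ℝ) + N) = n + 3 / 2 - N by ring,
    show 3 / 2 - ((n : ℝ) - N + 1 - q - ε) = -n + q + 1 / 2 + N + ε by ring,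
    hyperSum_swap_lower, mul_assoc]

theorem poch_neg_half_sub (N : ℕ) : poch (-(1 / 2) - N) N = (-1) ^ N * poch (3 / 2) N := by
  rw [show -(1 / 2) - (N : ℝ) = -(1 / 2 + N) by ring, poch_neg]
  ring_nf

theorem two_pow_mul_poch_half (m : ℕ) :
    (2 : ℝ) ^ m * poch (1 / 2) m = ((2 * m - 1).doubleFactorial : ℝ) := by
  induction m with
  | zero => simp
  | succ m ih =>
    rcases m with _ | m
    · simp [poch_succ]
    · rw [show 2 * (m + 1 + 1) - 1 = 2 * (m + 1) - 1 + 2 by omega, Nat.doubleFactorial_add_two,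
        poch_succ, pow_succ, Nat.cast_mul, ← ih, show 2 * (m + 1) - 1 + 2 = 2 * m + 3 by omega]
      push_cast; ring

theorem two_pow_mul_poch_three_halves (m : ℕ) :
    (2 : ℝ) ^ m * poch (3 / 2) m = ((2 * m + 1).doubleFactorial : ℝ) := by
  have := two_pow_mul_poch_half (m + 1)
  rw [poch_succ_left, show 2 * (m + 1) - 1 = 2 * m + 1 by omega] at this
  rw [← this, pow_succ, show (1 / 2 : ℝ) + 1 = 3 / 2 by norm_num]
  ring

theorem prod_two_mul_sub (x : ℝ) (m : ℕ) :
    ∏ r ∈ range m, (2 * x - 2 * r) = 2 ^ m * poch (x + 1 - m) m := by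
  induction m with
  | zero => simp
  | succ m ih =>
    rw [prod_range_succ, ih, poch_succ_left, pow_succ]
    push_cast
    rw [show x + 1 - (m + 1) + 1 = x + 1 - (m : ℝ) by ring]
    ring

/-- The constant relating a matrix entry to the final `₄F₃`. -/
theorem entryTerm_zero_mul_const {n q N ε : ℕ} (hε : ε ≤ 1) (hN : N + ε ≤ q)
    (hin : 2 * q + 1 ≤ n) :
    2 * (-entryTerm n q (2 * N + ε) 0 *
      (poch (-(1 / 2) - N) N * poch (q + 1 - N) N / (poch (-n - 1 / 2) N * poch (-n + q + 1) N) *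
      (poch (1 / 2 - N - ε) N * poch (-N - ε) N / (poch (1 / 2 - q) N * poch (-q) N)))) =
    (-1) ^ (q - N + 1) * ((2 * N + 1).doubleFactorial * (2 * (q - N) - 1).doubleFactorial /
      (2 ^ q * poch (n - q - N) (q + 1))) * (((2 * n - 2 * N + 1) * (N + 1)) ^ ε) := by
  obtain ⟨x, hx⟩ := Nat.exists_eq_add_of_le (show N ≤ q by omega)
  have hNq : (N : ℝ) + ε ≤ q := by exact_mod_cast hN
  have hxr : (q : ℝ) = N + x := by rw [hx]; push_cast; ring
  have hqn : 2 * (q : ℝ) + 1 ≤ n := by exact_mod_cast hin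
  have hε0 : (0 : ℝ) ≤ ε := by positivity
  have hN0 : (0 : ℝ) ≤ N := by positivity
  have hx0 : (0 : ℝ) ≤ x := by positivity
  -- reflected Pochhammer symbols
  have r1 := poch_neg_half_sub N
  have r2 : poch (-n - 1 / 2) N = (-1) ^ N * poch (n + 3 / 2 - N) N := by
    rw [show -(n : ℝ) - 1 / 2 = -(n + 1 / 2) by ring, poch_neg]; ring_nf
  have r3 : poch (-n + q + 1) N = (-1) ^ N * poch (n - q - N) N := by
    rw [show -(n : ℝ) + q + 1 = -(n - q - 1) by ring, poch_neg]; ring_nf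
  have r4 : poch (1 / 2 - N - ε) N = (-1) ^ N * poch (1 / 2 + ε) N := by
    rw [show 1 / 2 - (N : ℝ) - ε = -(N + ε - 1 / 2) by ring, poch_neg]; ring_nf
  have r5 : poch (-N - ε) N = (-1) ^ N * poch (1 + ε) N := by
    rw [show -(N : ℝ) - ε = -(N + ε) by ring, poch_neg]; ring_nf
  have r6 : poch (1 / 2 - q) N = (-1) ^ N * poch (1 / 2 + x) N := by
    rw [show 1 / 2 - (q : ℝ) = -(q - 1 / 2) by ring, poch_neg, hxr]; ring_nf
  have r7 : poch (-q) N = (-1) ^ N * poch (1 + x) N := by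
    rw [poch_neg, hxr]; ring_nf
  have r8 : poch ((q : ℝ) + 1 - N) N = poch (1 + x) N := by rw [hxr]; ring_nf
  -- the products in the first summand
  have p1 : ∏ m ∈ range (q + 1), (2 * (n : ℝ) + 1 - 2 * (0 : ℕ) - 2 * m) =
      2 ^ (q + 1) * (poch (n - q + 1 / 2) (x + 1) * poch (n - N + 3 / 2) N) := by
    have := prod_two_mul_sub (n + 1 / 2) (q + 1)
    rw [show (n : ℝ) - N + 3 / 2 = n - q + 1 / 2 + (x + 1 : ℕ) by rw [hxr]; push_cast; ring,
      ← poch_add, show x + 1 + N = q + 1 by omega,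
      show (n : ℝ) - q + 1 / 2 = n + 1 / 2 + 1 - (q + 1 : ℕ) by push_cast; ring, ← this]
    exact prod_congr rfl fun m _ => by push_cast; ring
  have p2 : ∏ m ∈ range q, (2 * ((0 : ℕ) : ℝ) - 1 - 2 * m) =
      2 ^ q * ((-1) ^ q * (poch (1 / 2) x * poch (1 / 2 + x) N)) := by
    have := prod_two_mul_sub (-1 / 2) q
    rw [← poch_add, show x + N = q by omega]
    rw [show (-1 / 2 + 1 - (q : ℝ)) = -(q - 1 / 2) by ring, poch_neg,
      show (q : ℝ) - 1 / 2 - q + 1 = 1 / 2 by ring] at this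
    rw [← this]
    exact prod_congr rfl fun m _ => by push_cast; ring
  have p3 : poch ((n : ℝ) - q - N) (q + 1) = poch (n - q - N) N * poch (n - q) (x + 1) := by
    rw [show q + 1 = N + (x + 1) by omega, poch_add]; ring_nf
  have p4 : ((2 * n - 2 * N + 1).factorial : ℝ) = (2 * n - (2 * q + 1)).factorial *
      (4 ^ (x + 1) * poch (n - q) (x + 1) * poch (n - q + 1 / 2) (x + 1)) := by
    have h1 := factorial_mul_poch (2 * n - (2 * q + 1)) (2 * (x + 1))
    rw [poch_two_mul, show 2 * n - (2 * q + 1) + 2 * (x + 1) = 2 * n - 2 * N + 1 by omega,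
      Nat.cast_sub (by omega)] at h1
    rw [← h1]
    push_cast
    congr 3 <;> ring_nf
  have p5 : ((2 * N).factorial : ℝ) = 4 ^ N * poch (1 / 2) N * poch 1 N := by
    have := poch_two_mul 1 N
    rw [poch_one] at this
    rw [this]; norm_num
  have d1 := two_pow_mul_poch_three_halves N
  have d2 := two_pow_mul_poch_half x
  have e1 : entryTerm n q (2 * N + ε) 0 =
      (2 * n - (2 * q + 1)).factorial / ((2 * N + ε).factorial * (2 * n - (2 * N + ε) + 1).factorial) *
      (2 ^ (q + 1) * (poch (n - q + 1 / 2) (x + 1) * poch (n - N + 3 / 2) N)) *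
      (2 ^ q * ((-1) ^ q * (poch (1 / 2) x * poch (1 / 2 + x) N))) := by
    rw [entryTerm, p2]
    have := p1
    push_cast at this ⊢
    rw [this]
    simp
  have e2 : (poch (1 / 2 + ε) N * poch (1 + ε) N) * ((2 * n - 2 * N + 1).factorial *
      (2 * N).factorial) = (poch (1 / 2) N * poch 1 N * ((2 * n - 2 * N + 1) * (N + 1)) ^ ε) *
      ((2 * n - (2 * N + ε) + 1).factorial * (2 * N + ε).factorial) := by
    interval_cases ε
    · simp
    · have h1 := poch_succ_left (1 / 2) N
      have h2 := poch_succ_left 1 N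
      rw [poch_succ] at h1 h2
      have h3 : poch (1 / 2 + 1) N = 2 * (poch (1 / 2) N * (1 / 2 + N)) := by rw [h1]; ring
      have h4 : poch (1 + 1) N = poch 1 N * (1 + N) := by rw [h2]; ring
      rw [show 2 * n - (2 * N + 1) + 1 = 2 * n - 2 * N by omega, Nat.factorial_succ (2 * n - 2 * N),
        Nat.factorial_succ (2 * N), Nat.cast_one, h3, h4]
      push_cast [Nat.cast_sub (show 2 * N ≤ 2 * n by omega)]
      ring
  -- After those cancellations this relation is the only nontrivial one left. It combines the
  -- duplication formulas with the correction `e2` for odd `j`.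
  have c1 : poch (1 / 2 + ε) N * poch (1 + ε) N * (2 * n - (2 * q + 1)).factorial *
      (4 ^ (x + 1) * poch (n - q) (x + 1) * poch (n - q + 1 / 2) (x + 1)) * 4 ^ N =
      ((2 * n - 2 * N + 1) * (N + 1)) ^ ε *
      ((2 * n - (2 * N + ε) + 1).factorial * (2 * N + ε).factorial) := by
    have hh := (poch_pos (show (0 : ℝ) < 1 / 2 by norm_num) N).ne'
    have h1 := (poch_pos one_pos N).ne'
    apply mul_right_cancel₀ (mul_ne_zero hh h1)
    rw [p4, p5] at e2
    linear_combination e2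
  have n1 : poch ((n : ℝ) + 3 / 2 - N) N ≠ 0 := (poch_pos (by linarith) N).ne'
  have n2 : poch ((n : ℝ) - q - N) N ≠ 0 := (poch_pos (by linarith) N).ne'
  have n3 : poch ((n : ℝ) - q) (x + 1) ≠ 0 := (poch_pos (by linarith) _).ne'
  have n4 : poch (1 / 2 + (x : ℝ)) N ≠ 0 := (poch_pos (by linarith) _).ne'
  have n5 : poch (1 + (x : ℝ)) N ≠ 0 := (poch_pos (by linarith) _).ne'
  have n6 : ((2 * n - (2 * N + ε) + 1).factorial : ℝ) ≠ 0 := by positivity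
  have n7 : ((2 * N + ε).factorial : ℝ) ≠ 0 := by positivity
  rw [e1, r1, r2, r3, r4, r5, r6, r7, r8, p3, show q - N = x by omega, ← d1, ← d2,
    show (n : ℝ) - N + 3 / 2 = n + 3 / 2 - N by ring]
  clear e1 r1 r2 r3 r4 r5 r6 r7 r8 p1 p2 p3 p4 p5 d1 d2 e2
  generalize poch ((n : ℝ) + 3 / 2 - N) N = y1 at *
  generalize poch ((n : ℝ) - q - N) N = y2 at *
  generalize poch ((n : ℝ) - q) (x + 1) = y3 at *
  generalize poch (1 / 2 + (x : ℝ)) N = y4 at *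
  generalize poch (1 + (x : ℝ)) N = y5 at *
  generalize poch ((n : ℝ) - q + 1 / 2) (x + 1) = y6 at *
  generalize ((2 * n - (2 * N + ε) + 1).factorial : ℝ) = y7 at *
  generalize ((2 * N + ε).factorial : ℝ) = y8 at *
  generalize poch (1 / 2 + (ε : ℝ)) N = y9 at *
  generalize poch (1 + (ε : ℝ)) N = y10 at *
  generalize ((2 * n - 2 * N + 1 : ℝ) * (N + 1)) ^ ε = y11 at *
  generalize ((2 * n - (2 * q + 1)).factorial : ℝ) = y12 at *
  generalize poch (3 / 2) N = y13 at *
  generalize poch (1 / 2) x = y14 at *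
  have s0 : (-1 : ℝ) ^ N ≠ 0 := by simp
  have h4 : ∀ k : ℕ, (4 : ℝ) ^ k = (2 ^ k) ^ 2 := fun k => by
    rw [← pow_mul, mul_comm, pow_mul]; norm_num
  rw [h4, h4, pow_succ (2 : ℝ) x] at c1
  have z1 : (2 : ℝ) ^ N ≠ 0 := by positivity
  have z2 : (2 : ℝ) ^ x ≠ 0 := by positivity
  rw [hx]
  simp only [pow_add, pow_one]
  generalize (2 : ℝ) ^ N = t1 at *
  generalize (2 : ℝ) ^ x = t2 at *
  generalize (-1 : ℝ) ^ N = t3 at *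
  generalize (-1 : ℝ) ^ x = t4 at *
  field_simp
  linear_combination (-(t4 * y14 * y13)) * c1

/-! ### Assembly -/

theorem hypergeom_eq_hyperSum (N : ℕ) (a b c d e f : ℝ) :
    hypergeom [-(N : ℝ), a, b, c] [d, e, f] 1 = hyperSum N a b c d e f := by
  rw [hypergeom, tsum_eq_sum (s := range (N + 1)), hyperSum]
  · refine sum_congr rfl fun k _ => ?_
    simp [mul_assoc]
  · intro k hk
    rw [mem_range, not_lt] at hk
    simp [poch_neg_natCast_eq_zero (show N < k by omega)]

theorem D1_odd_eq_hyperSum {n q N ε : ℕ} (hε : ε ≤ 1) (hN : N + ε ≤ q) (hin : 2 * q + 1 ≤ n)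
    (hr : n - (2 * q + 1) < n + 1) (hc : n - (2 * N + ε) < n + 1) :
    D1 n ⟨n - (2 * q + 1), hr⟩ ⟨n - (2 * N + ε), hc⟩ =
      (-1) ^ (q - N + 1) * ((2 * N + 1).doubleFactorial * (2 * (q - N) - 1).doubleFactorial /
        (2 ^ q * √2 * poch (n - q - N) (q + 1))) * √(2 * (n - (2 * q + 1 : ℕ)) + 1) *
        √(2 * ((n : ℝ) - (2 * N + ε : ℕ)) + 1) * ((2 * n - 2 * N + 1) * (N + 1)) ^ ε *
        hyperSum N (N - q + ε) (n + 3 / 2 - N) (-n + q + 1 / 2 + N + ε) (1 + ε) (1 / 2 + ε)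
          (3 / 2) := by
  rw [D1_odd_eq_sum_entryTerm hin (by omega), show (2 * N + ε) / 2 = N by omega]
  have hsum : ∑ s ∈ range (N + 1), entryTerm n q (2 * N + ε) s =
      entryTerm n q (2 * N + ε) 0 * hyperSum N (-n + N) (1 / 2 - N - ε) (-n + N - 1 / 2 + ε)
        (1 / 2 - q) (-n - 1 / 2) (-n + q + 1) := by
    rw [hyperSum, mul_sum]
    exact sum_congr rfl fun s hs =>
      entryTerm_eq hε (by simpa [Nat.lt_succ_iff] using hs) hN hin
  have hK := entryTerm_zero_mul_const hε hN hin
  have h2 : √2 ≠ 0 := by positivity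
  have h22 : √2 * √2 = 2 := Real.mul_self_sqrt (by norm_num)
  rw [hsum, hyperSum_two_step hN hin]
  generalize hyperSum N (N - q + ε) (n + 3 / 2 - N) (-n + q + 1 / 2 + N + ε) (1 + ε) (1 / 2 + ε)
    (3 / 2) = H
  have hY : ((2 * N + 1).doubleFactorial : ℝ) * (2 * (q - N) - 1).doubleFactorial /
      (2 ^ q * √2 * poch (n - q - N) (q + 1)) =
    ((2 * N + 1).doubleFactorial : ℝ) * (2 * (q - N) - 1).doubleFactorial /
      (2 ^ q * poch (n - q - N) (q + 1)) / √2 := by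
    rw [div_div, mul_right_comm]
  rw [hY]
  generalize ((2 * N + 1).doubleFactorial : ℝ) * (2 * (q - N) - 1).doubleFactorial /
    ((2 : ℝ) ^ q * poch (n - q - N) (q + 1)) = Y at *
  generalize (poch (-(1 / 2) - N) N * poch (q + 1 - N) N /
      (poch (-n - 1 / 2) N * poch (-n + q + 1) N) *
    (poch (1 / 2 - N - ε) N * poch (-N - ε) N / (poch (1 / 2 - q) N * poch (-q) N)) : ℝ) = K at *
  generalize ((2 * (n : ℝ) - 2 * N + 1) * (N + 1)) ^ ε = Z at *
  -- Multiplying by `√2` supplies the factor 2 in `hK`; the target's `√2` comes from `2 ^ (i / 2) =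
  -- 2 ^ q * √2`.
  apply mul_left_cancel₀ h2
  have hc : √2 * (Y / √2) = Y := by field_simp
  linear_combination √(2 * ((n : ℝ) - (2 * q + 1 : ℕ)) + 1) *
    √(2 * ((n : ℝ) - (2 * N + ε : ℕ)) + 1) * H * (hK - entryTerm n q (2 * N + ε) 0 * K * h22) -
    (-1) ^ (q - N + 1) * √(2 * ((n : ℝ) - (2 * q + 1 : ℕ)) + 1) *
    √(2 * ((n : ℝ) - (2 * N + ε : ℕ)) + 1) * Z * H * hc

theorem two_rpow_odd_div_two (q : ℕ) : (2 : ℝ) ^ ((2 * (q : ℝ) + 1) / 2) = 2 ^ q * √2 := by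
  rw [show (2 * (q : ℝ) + 1) / 2 = q + 1 / 2 by ring, Real.rpow_add two_pos, Real.rpow_natCast,
    Real.sqrt_eq_rpow]

end AlpertWavelet

theorem lemma4 (n i j : ℕ) (hji : j < i) (hin : i ≤ n) :
    (Odd i → Even j →
      AlpertWavelet.D1 n ⟨n - i, by omega⟩ ⟨n - j, by omega⟩ =
        (-1) ^ ((i - j + 1) / 2) *
          (((j + 1).doubleFactorial : ℝ) * ((i - j - 2).doubleFactorial : ℝ) /
            ((2 : ℝ) ^ ((i : ℝ) / 2) *
              AlpertWavelet.poch ((n : ℝ) - ((i : ℝ) + j - 1) / 2) ((i + 1) / 2))) *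
          √(2 * ((n : ℝ) - i) + 1) * √(2 * ((n : ℝ) - j) + 1) *
          AlpertWavelet.hypergeom
            [-(j : ℝ) / 2, ((j : ℝ) - i + 1) / 2, (n : ℝ) + (3 - (j : ℝ)) / 2,
              -(n : ℝ) + ((i : ℝ) + j) / 2]
            [1, 1 / 2, 3 / 2] 1) ∧
    (Odd i → Odd j →
      AlpertWavelet.D1 n ⟨n - i, by omega⟩ ⟨n - j, by omega⟩ =
        (-1) ^ ((i - j) / 2 + 1) *
          ((j.doubleFactorial : ℝ) * ((i - j - 1).doubleFactorial : ℝ) /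
            ((2 : ℝ) ^ (((i : ℝ) + 2) / 2) *
              AlpertWavelet.poch ((n : ℝ) - ((i : ℝ) + j - 2) / 2) ((i + 1) / 2))) *
          √(2 * ((n : ℝ) - i) + 1) * √(2 * ((n : ℝ) - j) + 1) *
          (2 * (n : ℝ) - j + 2) * ((j : ℝ) + 1) *
          AlpertWavelet.hypergeom
            [-((j : ℝ) - 1) / 2, ((j : ℝ) - i) / 2 + 1, (n : ℝ) - (j : ℝ) / 2 + 2,
              -(n : ℝ) + ((i : ℝ) + j + 1) / 2]
            [2, 3 / 2, 3 / 2] 1) ∧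
    (Even i →
      (∀ hj : 1 ≤ j,
        AlpertWavelet.D1 n ⟨n - i, by omega⟩ ⟨n - j, by omega⟩ =
          AlpertWavelet.D1 (n - 1) ⟨n - i, by omega⟩ ⟨n - j, by omega⟩) ∧
      (j = 0 → AlpertWavelet.D1 n ⟨n - i, by omega⟩ ⟨n - j, by omega⟩ = 0)) := by
  refine ⟨?_, ?_, ?_⟩
  · rintro ⟨q, rfl⟩ ⟨N, hN⟩
    obtain rfl : j = 2 * N := by omega
    have key := AlpertWavelet.D1_odd_eq_hyperSum (n := n) (q := q) (N := N) (ε := 0) (by omega)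
      (by omega) hin (by omega) (by omega)
    rw [← AlpertWavelet.hypergeom_eq_hyperSum] at key
    simp only [Nat.cast_zero, add_zero, pow_zero, mul_one] at key
    rw [key, show (2 * q + 1 - 2 * N + 1) / 2 = q - N + 1 by omega,
      -- For `q = N` both truncated differences are 0, and `0!! = 1` agrees with the convention
      -- `(-1)!! = 1`.
      show 2 * q + 1 - 2 * N - 2 = 2 * (q - N) - 1 by omega,
      show (2 * q + 1 + 1) / 2 = q + 1 by omega]
    push_cast
    rw [AlpertWavelet.two_rpow_odd_div_two,
      show (n : ℝ) - (2 * (q : ℝ) + 1 + 2 * N - 1) / 2 = n - q - N by ring,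
      show -(2 * (N : ℝ)) / 2 = -N by ring,
      show (2 * (N : ℝ) - (2 * q + 1) + 1) / 2 = N - q by ring,
      show (n : ℝ) + (3 - 2 * N) / 2 = n + 3 / 2 - N by ring,
      show -(n : ℝ) + (2 * q + 1 + 2 * N) / 2 = -n + q + 1 / 2 + N by ring]
  · rintro ⟨q, rfl⟩ ⟨N, rfl⟩
    have key := AlpertWavelet.D1_odd_eq_hyperSum (n := n) (q := q) (N := N) (ε := 1) le_rfl
      (by omega) hin (by omega) (by omega)
    rw [← AlpertWavelet.hypergeom_eq_hyperSum] at key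
    rw [key, show (2 * q + 1 - (2 * N + 1)) / 2 + 1 = q - N + 1 by omega,
      show 2 * q + 1 - (2 * N + 1) - 1 = 2 * (q - N) - 1 by omega,
      show (2 * q + 1 + 1) / 2 = q + 1 by omega]
    push_cast
    rw [show (2 * (q : ℝ) + 1 + 2) / 2 = (2 * q + 1) / 2 + 1 by ring, Real.rpow_add two_pos,
      Real.rpow_one, AlpertWavelet.two_rpow_odd_div_two,
      show (n : ℝ) - (2 * (q : ℝ) + 1 + (2 * N + 1) - 2) / 2 = n - q - N by ring,
      show -(2 * (N : ℝ) + 1 - 1) / 2 = -N by ring,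
      show (2 * (N : ℝ) + 1 - (2 * q + 1)) / 2 + 1 = N - q + 1 by ring,
      show (n : ℝ) - (2 * N + 1) / 2 + 2 = n + 3 / 2 - N by ring,
      show -(n : ℝ) + (2 * q + 1 + (2 * N + 1) + 1) / 2 = -n + q + 1 / 2 + N + 1 by ring,
      show (1 : ℝ) + 1 = 2 by norm_num, show (1 / 2 : ℝ) + 1 = 3 / 2 by norm_num]
    -- The extra factor 2 in `2 ^ ((i + 2) / 2)` is absorbed by `j + 1 = 2 (N + 1)`.
    ring
  · intro hi
    refine ⟨fun hj => AlpertWavelet.D1_even_eq hi (by omega) hin _ _ _ _, ?_⟩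
    rintro rfl
    exact AlpertWavelet.D1_even_zero hi hji hin _ _
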